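/- Let $\tau\in\mathbb{C}$ with $\operatorname{Im}\tau>0$, put $q^{s}:=e^{2\pi i\tau s}$ for real $s$ (so $q=e^{2\pi i\tau}$), $J_m:=\prod_{i\ge 1}(1-q^{mi})$, $\eta(\tau):=q^{1/24}\prod_{n\ge1}(1-q^n)$, and for $x,y\in\mathbb{C}\setminus\{0\}$ let $$f_{a,b,c}(x,y,q):=\Big(\sum_{r,s\ge 0}-\sum_{r,s<0}\Big)(-1)^{r+s}x^ry^sq^{a\binom r2+brs+c\binom s2}\qquad (r,s\in\mathbb{Z}).$$ Let $c_{11}^{11}(\tau)$ be the level-$2$ string function of type $A_1^{(1)}$ with $\Lambda=\lambda=\Lambda_0+\Lambda_1$, in its Kac–Peterson form $$c_{11}^{11}(\tau)=\frac1{\eta(\tau)^3}\sum_{(x,y)}\mathrm{sg}(x)\,q^{4x^2-2y^2},$$ where the sum runs over all $(x,y)\in\mathbb{R}^2$ with $-|x|<y\le|x|$ such that $(x,y)$ or $(\tfrac12-x,\tfrac12+y)$ lies in $(\tfrac14,\tfrac14)+\mathbb{Z}^2$, and $\mathrm{sg}(x)=1$ for $x\ge0$, $\mathrm{sg}(x)=-1$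 for $x<0$. Then the double sums below converge absolutely, and $$f_{2,2,1}(q^2,q,q)=J_1J_2 .$$ Moreover $\eta(\tau)^3c_{11}^{11}(\tau)=q^{1/8}f_{2,2,1}(q^2,q,q)$, so that this identity is equivalent to the Kac–Peterson evaluation, which therefore holds as well: $$c_{11}^{11}(\tau)=\eta(\tau)^{-2}\eta(2\tau).$$ -/

import Mathlib

open UpperHalfPlane

noncomputable section

namespace HeckeString

/-- The nome `q = e^{2π i τ}`. -/
def nome (τ : ℂ) : ℂ := Complex.exp (2 * Real.pi * Complex.I * τ)

/-- The binomial coefficient `r (r - 1) / 2` for an arbitrary integer `r` (the division is exact). -/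
def binom2 (r : ℤ) : ℤ := r * (r - 1) / 2

/-- `J_m = ∏_{i ≥ 1} (1 - q^{m i})`. -/
def J (m : ℕ) (q : ℂ) : ℂ := ∏' i : ℕ, (1 - q ^ (m * (i + 1)))

/-- The general term `(-1)^{r+s} x^r y^s q^{a C(r,2) + b r s + c C(s,2)}` of a Hecke-type
double sum. -/
def heckeTerm (a b c : ℤ) (x y q : ℂ) (p : ℤ × ℤ) : ℂ :=
  (-1) ^ (p.1 + p.2) * x ^ p.1 * y ^ p.2 *
    q ^ (a * binom2 p.1 + b * p.1 * p.2 + c * binom2 p.2)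

/-- The pairs `(r, s)` with `r, s ≥ 0`. -/
def nonnegQuadrant : Set (ℤ × ℤ) := {p | 0 ≤ p.1 ∧ 0 ≤ p.2}

/-- The pairs `(r, s)` with `r, s < 0`. -/
def negQuadrant : Set (ℤ × ℤ) := {p | p.1 < 0 ∧ p.2 < 0}

/-- The Hecke-type double sum `f_{a,b,c}(x, y, q)`: the sum over `r, s ≥ 0` minus the sum over
`r, s < 0`. -/
def heckeF (a b c : ℤ) (x y q : ℂ) : ℂ :=
  (∑' p : nonnegQuadrant, heckeTerm a b c x y q p) -
    ∑' p : negQuadrant, heckeTerm a b c x y q p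

/-- `sg(x) = 1` for `x ≥ 0` and `-1` for `x < 0`. -/
def sg (x : ℝ) : ℝ := if 0 ≤ x then 1 else -1

/-- Membership in the translated lattice `((ℓ + 1) / (2 (N + 2)), m / (2 N)) + ℤ²`. -/
def inShiftedLattice (N l m : ℕ) (x y : ℝ) : Prop :=
  ∃ a b : ℤ, x = ((l : ℝ) + 1) / (2 * ((N : ℝ) + 2)) + a ∧ y = (m : ℝ) / (2 * (N : ℝ)) + b

/-- The index set of the Kac–Peterson double sum at level `N`. -/
def kpIndex (N l m : ℕ) : Set (ℝ × ℝ) :=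
  {p | -|p.1| < p.2 ∧ p.2 ≤ |p.1| ∧
    (inShiftedLattice N l m p.1 p.2 ∨ inShiftedLattice N l m (1 / 2 - p.1) (1 / 2 + p.2))}

/-- The general term `sg(x) q^{(N+2) x² - N y²}` with `q^s = e^{2π i τ s}` for real `s`. -/
def kpTerm (N : ℕ) (τ : ℂ) (p : ℝ × ℝ) : ℂ :=
  (sg p.1 : ℂ) * Complex.exp (2 * Real.pi * Complex.I * τ *
    ((((N : ℝ) + 2) * p.1 ^ 2 - (N : ℝ) * p.2 ^ 2 : ℝ) : ℂ))

/-- The level-`N` string function `c_{N-m,m}^{N-ℓ,ℓ}(τ)` of type `A_1^{(1)}`, in the form of the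
Kac–Peterson indefinite double sum divided by `η(τ)^3`. -/
def stringFunction (N l m : ℕ) (τ : ℂ) : ℂ :=
  (ModularForm.eta τ ^ 3)⁻¹ * ∑' p : kpIndex N l m, kpTerm N τ p

end HeckeString

end

/-! Put `n = r + s`, `j = s` on the nonnegative quadrant and `n = -1 - r - s`, `j = s` on the
negative one. Since `n (n + 1)` is invariant under `n ↦ -1 - n` while `(-1)^n` changes sign, the two
signed quadrants merge into one sum `D` of `(-1)^n q^{n (n + 1) - tri j}` over `|j| ≤ n`.

To evaluate `D`, multiply by `θ = ∑ q^{tri t}`, which for each `j` is twice its part over `t = 2a +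
j`. The quadratic terms in `j` then cancel, leaving the exponent `n (n + 1) + 2a² + a (2j + 1)`. For
fixed `a`, the `j`-sum is geometric. If `a ≠ 0`, its two end terms make the `n`-sum a bilateral
alternating theta series that vanishes by symmetry (`tsum_tripleTerm_of_ne_zero`). If `a = 0`,
Jacobi's identity gives `J₂³` (`tsum_tripleTerm_zero`). Hence `D θ = 2 J₂³`, and Gauss's `θ J₁ = 2
J₂²` yields `D = J₁ J₂` (`tsum_triTerm`). Both classical identities are limits of a finite Jacobi
triple product.

The Kac–Peterson index set is parametrized by the same pairs `(n, j)`, its terms being `q^{1/8}`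
times those of `D`. As `η(τ) η(2τ) = q^{1/8} J₁ J₂`, the string function follows on division by
`η(τ)³`. -/

namespace HeckeString

open Filter Topology Finset

/-! ### Gaussian binomials and the finite `q`-binomial theorem -/

/-- The finite product `∏_{i=1}^{N} (1 - q^i)`. -/
noncomputable def qPoch (q : ℂ) (N : ℕ) : ℂ := ∏ i ∈ range N, (1 - q ^ (i + 1))

/-- The Gaussian binomial coefficient, defined by the `q`-Pascal recursion. -/
noncomputable def gaussBinom (q : ℂ) : ℕ → ℕ → ℂ
  | _, 0 => 1
  | 0, _ + 1 => 0
  | M + 1, k + 1 => q ^ (k + 1) * gaussBinom q M (k + 1) + gaussBinom q M k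

theorem gaussBinom_zero_right (q : ℂ) (M : ℕ) : gaussBinom q M 0 = 1 := by
  cases M <;> rfl

theorem gaussBinom_succ_succ (q : ℂ) (M k : ℕ) :
    gaussBinom q (M + 1) (k + 1) = q ^ (k + 1) * gaussBinom q M (k + 1) + gaussBinom q M k := rfl

theorem gaussBinom_eq_zero (q : ℂ) : ∀ {M k : ℕ}, M < k → gaussBinom q M k = 0
  | 0, _ + 1, _ => rfl
  | M + 1, k + 1, h => by
    rw [gaussBinom_succ_succ, gaussBinom_eq_zero q (show M < k + 1 by omega),
      gaussBinom_eq_zero q (show M < k by omega)]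
    ring

theorem qPoch_succ (q : ℂ) (N : ℕ) : qPoch q (N + 1) = qPoch q N * (1 - q ^ (N + 1)) :=
  prod_range_succ _ _

/-- The usual quotient formula with denominators cleared, so that Pascal induction works for every
`q`, roots of unity included. -/
theorem gaussBinom_mul_qPoch (q : ℂ) : ∀ k l : ℕ,
    gaussBinom q (k + l) k * (qPoch q k * qPoch q l) = qPoch q (k + l)
  | 0, l => by simp [gaussBinom_zero_right, qPoch]
  | k + 1, 0 => by
    have h := gaussBinom_mul_qPoch q k 0
    simp only [add_zero] at h ⊢
    rw [gaussBinom_succ_succ, gaussBinom_eq_zero q (Nat.lt_succ_self k), qPoch_succ]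
    linear_combination (1 - q ^ (k + 1)) * h
  | k + 1, l + 1 => by
    have h1 := gaussBinom_mul_qPoch q (k + 1) l
    have h2 := gaussBinom_mul_qPoch q k (l + 1)
    rw [show k + 1 + (l + 1) = (k + l + 1) + 1 by ring, gaussBinom_succ_succ,
      qPoch_succ q (k + l + 1)]
    rw [show k + 1 + l = k + l + 1 by ring] at h1
    rw [show k + (l + 1) = k + l + 1 by ring] at h2
    rw [qPoch_succ q k] at h1 ⊢
    rw [qPoch_succ q l] at h2 ⊢
    linear_combination q ^ (k + 1) * (1 - q ^ (l + 1)) * h1 + (1 - q ^ (k + 1)) * h2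

/-- The finite `q`-binomial theorem. -/
theorem prod_one_add_mul_pow (q : ℂ) (M : ℕ) : ∀ z : ℂ,
    ∏ i ∈ range M, (1 + z * q ^ i) =
      ∑ k ∈ range (M + 1), q ^ (k.choose 2) * gaussBinom q M k * z ^ k := by
  induction M with
  | zero => intro z; simp [gaussBinom_zero_right]
  | succ M ih =>
    intro z
    -- Splitting off the factor `i = 0` leaves the shorter product at `z q`.
    have h := ih (z * q)
    have e : ∀ i, 1 + z * q ^ (i + 1) = 1 + z * q * q ^ i := fun i => by ring
    rw [prod_range_succ', prod_congr rfl fun i _ => e i, h, sum_range_succ' _ (M + 1)]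
    simp only [gaussBinom_succ_succ, gaussBinom_zero_right, pow_zero, mul_one,
      Nat.choose_zero_succ]
    have s1 : ∑ k ∈ range (M + 1), q ^ (k.choose 2) * gaussBinom q M k * (z * q) ^ k =
        ∑ k ∈ range (M + 1), q ^ ((k + 1).choose 2) * (q ^ (k + 1) * gaussBinom q M (k + 1)) *
          z ^ (k + 1) + 1 := by
      have := sum_range_succ' (fun k => q ^ (k.choose 2) * gaussBinom q M k * (z * q) ^ k) (M + 1)
      rw [sum_range_succ, gaussBinom_eq_zero q (Nat.lt_succ_self M)] at this
      simp only [mul_zero, zero_mul, add_zero, gaussBinom_zero_right, Nat.choose_zero_succ,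
        pow_zero, mul_one] at this
      rw [this]
      congr 1
      refine sum_congr rfl fun k _ => ?_
      ring
    have s2 : (∑ k ∈ range (M + 1), q ^ (k.choose 2) * gaussBinom q M k * (z * q) ^ k) * z =
        ∑ k ∈ range (M + 1), q ^ ((k + 1).choose 2) * gaussBinom q M k * z ^ (k + 1) := by
      rw [sum_mul]
      refine sum_congr rfl fun k _ => ?_
      rw [Nat.choose_succ_succ' k 1, Nat.choose_one_right]
      ring
    rw [mul_add, mul_one, s2, s1]
    simp only [mul_add, add_mul, sum_add_distrib]
    ring

/-! ### Triangular numbers and the finite triple product -/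

/-- The triangular number `t (t + 1) / 2` of an integer. -/
def tri (t : ℤ) : ℤ := t * (t + 1) / 2

theorem two_mul_tri (t : ℤ) : 2 * tri t = t * (t + 1) :=
  Int.mul_ediv_cancel' (Int.even_mul_succ_self t).two_dvd

theorem tri_neg_one_sub (t : ℤ) : tri (-1 - t) = tri t := by
  have h1 := two_mul_tri t
  have h2 := two_mul_tri (-1 - t)
  have : 2 * tri (-1 - t) = 2 * tri t := by rw [h1, h2]; ring
  omega

theorem natAbs_sub_one_le_tri (t : ℤ) : (t.natAbs : ℤ) - 1 ≤ tri t := by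
  have h := two_mul_tri t
  rcases le_total 0 t with ht | ht
  · rw [Int.natAbs_of_nonneg ht]; nlinarith [sq_nonneg (t - 1)]
  · rw [Int.ofNat_natAbs_of_nonpos ht]
    rcases lt_or_ge (-2) t with h' | h'
    · obtain rfl | rfl : t = -1 ∨ t = 0 := by omega
      all_goals simp [tri]
    · nlinarith

theorem two_mul_sum_range_id (N : ℕ) :
    2 * ((∑ i ∈ range N, i : ℕ) : ℤ) = N * (N - 1) := by
  induction N with
  | zero => simp
  | succ N ih => rw [sum_range_succ]; push_cast at ih ⊢; linear_combination ih

theorem two_mul_choose_two (k : ℕ) : 2 * ((k.choose 2 : ℕ) : ℤ) = k * (k - 1) := by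
  induction k with
  | zero => simp
  | succ k ih =>
    rw [Nat.choose_succ_succ' k 1, Nat.choose_one_right]; push_cast; linear_combination ih

/-- The finite form of the Jacobi triple product, with denominators cleared. -/
theorem finite_triple_product {q : ℂ} (hq : q ≠ 0) (N : ℕ) (z : ℂ) :
    ∏ i ∈ range N, ((1 - z * q ^ (i + 1)) * (z - q ^ i)) =
      ∑ k ∈ range (2 * N + 1), (-1) ^ ((k : ℤ) - N) * q ^ tri ((k : ℤ) - N) *
        gaussBinom q (2 * N) k * z ^ k := by
  -- With this argument the powers of `q` in the `2N` factors run from `1 - N` to `N`. The upper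
  -- half gives `1 - z q^{i+1}`; the reflected lower half gives `z - q^i` after multiplication by
  -- `-q^i`.
  have h := prod_one_add_mul_pow q (2 * N) (-z * q ^ (1 - N : ℤ))
  rw [two_mul, prod_range_add, ← prod_range_reflect] at h
  have e1 : ∀ i ∈ range N, (1 - z * q ^ (i + 1)) * (z - q ^ i) =
      (-1) * q ^ i * ((1 + -z * q ^ (1 - N : ℤ) * q ^ (N - 1 - i)) *
        (1 + -z * q ^ (1 - N : ℤ) * q ^ (N + i))) := by
    intro i hi
    have hi' := mem_range.1 hi
    have a1 : q ^ (1 - N : ℤ) * q ^ (N + i) = q ^ (i + 1) := by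
      rw [← zpow_natCast, ← zpow_natCast, ← zpow_add₀ hq]; congr 1; push_cast; ring
    have a2 : q ^ (1 - N : ℤ) * q ^ (N - 1 - i) * q ^ i = 1 := by
      rw [← zpow_natCast, ← zpow_natCast, ← zpow_add₀ hq, ← zpow_add₀ hq]
      rw [show (1 - N : ℤ) + ((N - 1 - i : ℕ) : ℤ) + (i : ℤ) = 0 by omega, zpow_zero]
    have a3 : -z * q ^ (1 - N : ℤ) * q ^ (N + i) = -z * q ^ (i + 1) := by rw [mul_assoc, a1]
    rw [a3]
    linear_combination (-(1 - z * q ^ (i + 1)) * z) * a2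
  rw [prod_congr rfl e1, prod_mul_distrib, prod_mul_distrib, prod_mul_distrib, h, mul_sum, two_mul]
  refine sum_congr rfl fun k _ => ?_
  rw [prod_const, card_range, prod_pow_eq_pow_sum, mul_pow, neg_pow]
  have b1 : ((-1 : ℂ)) ^ ((k : ℤ) - N) = (-1) ^ N * (-1) ^ k := by
    rw [zpow_sub₀ (by norm_num), zpow_natCast, zpow_natCast, mul_comm, div_eq_mul_inv, ← inv_pow]
    norm_num [mul_comm]
  have b2 : q ^ tri ((k : ℤ) - N) = q ^ (∑ i ∈ range N, i) * (q ^ (k.choose 2) *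
      (q ^ (1 - N : ℤ)) ^ k) := by
    rw [← zpow_natCast, ← zpow_natCast, ← zpow_natCast, ← zpow_mul, ← zpow_add₀ hq,
      ← zpow_add₀ hq]
    congr 1
    have t := two_mul_tri ((k : ℤ) - N)
    have c1 := two_mul_sum_range_id N
    have c2 := two_mul_choose_two k
    have : 2 * tri ((k : ℤ) - N) =
        2 * (((∑ i ∈ range N, i : ℕ) : ℤ) + ((k.choose 2 : ℕ) + (1 - N : ℤ) * k)) := by
      rw [t]; linear_combination -c1 - c2
    exact mul_left_cancel₀ two_ne_zero this
  rw [b1, b2]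
  ring

/-! ### Passage to the limit -/

theorem J_eq_J_one_pow (m : ℕ) (q : ℂ) : J m q = J 1 (q ^ m) := by
  simp [J, pow_mul]

theorem one_sub_pow_ne_zero {q : ℂ} (hq : ‖q‖ < 1) (i : ℕ) : 1 - q ^ (i + 1) ≠ 0 := by
  intro h
  have h1 : ‖q ^ (i + 1)‖ < 1 := by
    rw [norm_pow]; exact pow_lt_one₀ (norm_nonneg _) hq (by omega)
  rw [← sub_eq_zero.1 h] at h1
  simp at h1

theorem tendsto_qPoch {q : ℂ} (hq : ‖q‖ < 1) : Tendsto (qPoch q) atTop (𝓝 (J 1 q)) := by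
  have := (ModularForm.multipliable_one_sub_pow hq).hasProd.tendsto_prod_nat
  have e : J 1 q = ∏' i : ℕ, (1 - q ^ (i + 1)) := by simp only [J, one_mul]
  rw [e]
  exact this

theorem J_one_ne_zero {q : ℂ} (hq : ‖q‖ < 1) : J 1 q ≠ 0 := by
  have := tprod_one_add_ne_zero_of_summable (f := fun n : ℕ => -q ^ (n + 1))
    (fun i => by simpa [sub_eq_add_neg] using one_sub_pow_ne_zero hq i)
    (by simpa using (summable_nat_add_iff 1).mpr (summable_geometric_of_lt_one (norm_nonneg _) hq))
  simpa only [J, one_mul, sub_eq_add_neg] using this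

theorem qPoch_ne_zero {q : ℂ} (hq : ‖q‖ < 1) (N : ℕ) : qPoch q N ≠ 0 :=
  prod_ne_zero_iff.2 fun i _ => one_sub_pow_ne_zero hq i

theorem gaussBinom_add_eq_div {q : ℂ} (hq : ‖q‖ < 1) (k l : ℕ) :
    gaussBinom q (k + l) k = qPoch q (k + l) * ((qPoch q k)⁻¹ * (qPoch q l)⁻¹) := by
  rw [← gaussBinom_mul_qPoch]
  field_simp [qPoch_ne_zero hq]

/-- Both `qPoch q n` and its inverse converge to finite limits, hence are bounded. The uniform
constant supplies the dominating function for the limit of central sums. -/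
theorem exists_norm_gaussBinom_le {q : ℂ} (hq : ‖q‖ < 1) :
    ∃ C : ℝ, ∀ M k : ℕ, ‖gaussBinom q M k‖ ≤ C := by
  obtain ⟨A, hA⟩ := (Metric.isBounded_range_of_tendsto _ (tendsto_qPoch hq)).exists_norm_le
  obtain ⟨B, hB⟩ := (Metric.isBounded_range_of_tendsto _
    ((tendsto_qPoch hq).inv₀ (J_one_ne_zero hq))).exists_norm_le
  have hA' : ∀ n, ‖qPoch q n‖ ≤ A := fun n => hA _ ⟨n, rfl⟩
  have hB' : ∀ n, ‖(qPoch q n)⁻¹‖ ≤ B := fun n => hB _ ⟨n, rfl⟩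
  have hA0 : 0 ≤ A := (norm_nonneg _).trans (hA' 0)
  have hB0 : 0 ≤ B := (norm_nonneg _).trans (hB' 0)
  refine ⟨A * (B * B), fun M k => ?_⟩
  rcases lt_or_ge M k with h | h
  · rw [gaussBinom_eq_zero q h, norm_zero]; positivity
  · obtain ⟨l, rfl⟩ := Nat.exists_eq_add_of_le h
    rw [gaussBinom_add_eq_div hq, norm_mul, norm_mul]
    gcongr
    · exact hA' _
    · exact hB' _
    · exact hB' _

theorem tendsto_gaussBinom {q : ℂ} (hq : ‖q‖ < 1) (n : ℤ) :
    Tendsto (fun N : ℕ => gaussBinom q (2 * N) (n + N).toNat) atTop (𝓝 (J 1 q)⁻¹) := by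
  have t1 : Tendsto (fun N : ℕ => (n + N).toNat) atTop atTop :=
    tendsto_atTop_atTop.2 fun b => ⟨b + n.natAbs, fun N hN => by omega⟩
  have t2 : Tendsto (fun N : ℕ => ((N : ℤ) - n).toNat) atTop atTop :=
    tendsto_atTop_atTop.2 fun b => ⟨b + n.natAbs, fun N hN => by omega⟩
  have t3 : Tendsto (fun N : ℕ => 2 * N) atTop atTop :=
    tendsto_atTop_atTop.2 fun b => ⟨b, fun N hN => by omega⟩
  have hP := tendsto_qPoch hq
  have hI := hP.inv₀ (J_one_ne_zero hq)
  have h := (hP.comp t3).mul ((hI.comp t1).mul (hI.comp t2))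
  rw [show J 1 q * ((J 1 q)⁻¹ * (J 1 q)⁻¹) = (J 1 q)⁻¹ by
    field_simp [J_one_ne_zero hq]] at h
  refine h.congr' ?_
  filter_upwards [eventually_ge_atTop n.natAbs] with N hN
  have e : 2 * N = (n + N).toNat + ((N : ℤ) - n).toNat := by omega
  have := gaussBinom_add_eq_div hq (n + N).toNat ((N : ℤ) - n).toNat
  rw [← e] at this
  simp [this]

/-- Weighted central Gaussian binomial sums converge to the weighted bilateral sum divided
by `J₁`. -/
theorem tendsto_sum_mul_gaussBinom {q : ℂ} (hq : ‖q‖ < 1) {w : ℤ → ℂ}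
    (hw : Summable fun n => ‖w n‖) :
    Tendsto (fun N : ℕ => ∑ k ∈ range (2 * N + 1), w ((k : ℤ) - N) * gaussBinom q (2 * N) k)
      atTop (𝓝 ((∑' n, w n) * (J 1 q)⁻¹)) := by
  obtain ⟨C, hC⟩ := exists_norm_gaussBinom_le hq
  have hC0 : 0 ≤ C := (norm_nonneg _).trans (hC 0 0)
  -- The finite sum is centred at `k = N` and extended by zero to all integers; on the interval
  -- `[-N, N]` the truncation `toNat` loses nothing.
  have h := tendsto_tsum_of_dominated_convergence (𝓕 := atTop)
    (f := fun (N : ℕ) (n : ℤ) =>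
      if n ∈ Icc (-(N : ℤ)) N then w n * gaussBinom q (2 * N) (n + N).toNat else 0)
    (g := fun n => w n * (J 1 q)⁻¹) (bound := fun n => ‖w n‖ * C) (hw.mul_right C)
    (fun n => by
      refine ((tendsto_gaussBinom hq n).const_mul (w n)).congr' ?_
      filter_upwards [eventually_ge_atTop n.natAbs] with N hN
      rw [if_pos (mem_Icc.2 ⟨by omega, by omega⟩)])
    (Eventually.of_forall fun N n => by
      split_ifs
      · rw [norm_mul]; gcongr; exact hC _ _
      · rw [norm_zero]; positivity)
  rw [tsum_mul_right] at h
  refine h.congr fun N => ?_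
  rw [tsum_eq_sum (s := Icc (-(N : ℤ)) N) fun n hn => if_neg hn]
  refine sum_nbij' (fun n => (n + N).toNat) (fun k => (k : ℤ) - N) ?_ ?_ ?_ ?_ ?_
  · intro n hn; rw [mem_Icc] at hn; rw [mem_range]; omega
  · intro k hk; rw [mem_range] at hk; rw [mem_Icc]; omega
  · intro n hn; rw [mem_Icc] at hn; omega
  · intro k hk; omega
  · intro n hn
    rw [if_pos hn]
    rw [mem_Icc] at hn
    rw [show (((n + N).toNat : ℕ) : ℤ) - N = n by omega]

/-! ### The identities of Jacobi and Gauss -/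

theorem summable_mul_zpow_tri {q : ℂ} (hq0 : q ≠ 0) (hq : ‖q‖ < 1) :
    Summable fun n : ℤ => ((n.natAbs : ℝ) + 1) * ‖q‖ ^ tri n := by
  have hpos : 0 < ‖q‖ := norm_pos_iff.2 hq0
  have hs : Summable fun n : ℕ => ((n : ℝ) + 1) * ‖q‖ ^ ((n : ℤ) - 1) := by
    have h1 := summable_pow_mul_geometric_of_norm_lt_one 1 (r := ‖q‖) (by simpa using hq)
    have h2 := summable_geometric_of_lt_one (norm_nonneg q) hq
    refine ((h1.add h2).mul_right ‖q‖⁻¹).congr fun n => ?_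
    rw [zpow_sub₀ hpos.ne', zpow_natCast, zpow_one]
    ring
  have hs' : Summable fun n : ℤ => ((n.natAbs : ℝ) + 1) * ‖q‖ ^ ((n.natAbs : ℤ) - 1) :=
    Summable.of_nat_of_neg (by simpa using hs) (by simpa using hs)
  refine hs'.of_nonneg_of_le (fun n => by positivity) fun n => ?_
  gcongr ?_ * ?_
  exact zpow_le_zpow_right_of_le_one₀ hpos hq.le (natAbs_sub_one_le_tri n)

theorem summable_zpow_tri {q : ℂ} (hq0 : q ≠ 0) (hq : ‖q‖ < 1) :
    Summable fun n : ℤ => ‖q ^ tri n‖ := by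
  refine (summable_mul_zpow_tri hq0 hq).of_nonneg_of_le (fun n => norm_nonneg _) fun n => ?_
  rw [norm_zpow]
  exact le_mul_of_one_le_left (by positivity) (by simp)

theorem norm_neg_one_zpow (n : ℤ) : ‖((-1 : ℂ)) ^ n‖ = 1 := by simp

theorem summable_neg_one_mul_zpow_tri {q : ℂ} (hq0 : q ≠ 0) (hq : ‖q‖ < 1) :
    Summable fun n : ℤ => ‖(-1) ^ n * q ^ tri n * (n : ℂ)‖ := by
  refine (summable_mul_zpow_tri hq0 hq).of_nonneg_of_le (fun n => norm_nonneg _) fun n => ?_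
  rw [norm_mul, norm_mul, norm_neg_one_zpow, one_mul, norm_zpow, mul_comm]
  gcongr
  rw [Complex.norm_intCast, Nat.cast_natAbs, Int.cast_abs]
  linarith

/-- Jacobi's identity for the cube of the Euler product, as a bilateral sum. -/
theorem tsum_neg_one_mul_zpow_tri {q : ℂ} (hq0 : q ≠ 0) (hq : ‖q‖ < 1) :
    ∑' n : ℤ, (-1) ^ n * q ^ tri n * (n : ℂ) = J 1 q ^ 3 := by
  -- Differentiate the finite triple product at `z = 1`. Its size is `N + 1` so that the factor `z -
  -- 1` is always present; the derivative is then the cofactor at `1`.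
  have hfin : ∀ N : ℕ, ∑ k ∈ range (2 * (N + 1) + 1),
      ((-1) ^ ((k : ℤ) - (N + 1 : ℕ)) * q ^ tri ((k : ℤ) - (N + 1 : ℕ)) *
        (((k : ℤ) - (N + 1 : ℕ) : ℤ) : ℂ)) * gaussBinom q (2 * (N + 1)) k =
      qPoch q (N + 1) * qPoch q N := by
    intro N
    set a : ℕ → ℂ := fun k => (-1) ^ ((k : ℤ) - (N + 1 : ℕ)) * q ^ tri ((k : ℤ) - (N + 1 : ℕ)) *
      gaussBinom q (2 * (N + 1)) k with ha
    have hprod : ∀ z : ℂ, (z - 1) * ((∏ i ∈ range (N + 1), (1 - z * q ^ (i + 1))) *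
        ∏ i ∈ range N, (z - q ^ (i + 1))) = ∑ k ∈ range (2 * (N + 1) + 1), a k * z ^ k := by
      intro z
      rw [← finite_triple_product hq0, prod_mul_distrib, prod_range_succ' (fun i => z - q ^ i)]
      rw [pow_zero]; ring
    -- The vanishing at `z = 1` allows the weight `k` from differentiation to be recentred to `k -
    -- (N + 1)`.
    have h0 : ∑ k ∈ range (2 * (N + 1) + 1), a k = 0 := by
      simpa using (hprod 1).symm
    have hR : DifferentiableAt ℂ (fun z : ℂ => (∏ i ∈ range (N + 1), (1 - z * q ^ (i + 1))) *
        ∏ i ∈ range N, (z - q ^ (i + 1))) 1 := by fun_prop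
    have d1 := ((hasDerivAt_id (1 : ℂ)).sub_const 1).mul hR.hasDerivAt
    have d2 : HasDerivAt (fun z : ℂ => ∑ k ∈ range (2 * (N + 1) + 1), a k * z ^ k)
        (∑ k ∈ range (2 * (N + 1) + 1), a k * ((k : ℂ) * 1 ^ (k - 1))) 1 :=
      HasDerivAt.fun_sum fun k _ => (hasDerivAt_pow k (1 : ℂ)).const_mul (a k)
    have d3 := d1.unique (d2.congr_of_eventuallyEq (Eventually.of_forall hprod))
    simp only [id, sub_self, zero_mul, add_zero, one_mul, one_pow, mul_one] at d3
    calc _ = ∑ k ∈ range (2 * (N + 1) + 1), (a k * (k : ℂ) - (N + 1 : ℂ) * a k) := by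
          refine sum_congr rfl fun k _ => ?_
          rw [ha]; push_cast; ring
      _ = _ := by
          rw [sum_sub_distrib, ← mul_sum, h0, mul_zero, sub_zero, ← d3]
          rfl
  have h := (tendsto_sum_mul_gaussBinom hq (summable_neg_one_mul_zpow_tri hq0 hq)).comp
    (tendsto_add_atTop_nat 1)
  have h2 := (((tendsto_qPoch hq).comp (tendsto_add_atTop_nat 1)).mul (tendsto_qPoch hq))
  have := tendsto_nhds_unique (h.congr fun N => by simpa using hfin N) h2
  have hJ := J_one_ne_zero hq
  field_simp at this
  rw [this]

theorem qPoch_sq {q : ℂ} (N : ℕ) :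
    qPoch (q ^ 2) N = qPoch q N * ∏ i ∈ range N, (1 + q ^ (i + 1)) := by
  rw [qPoch, qPoch, ← prod_mul_distrib]
  refine prod_congr rfl fun i _ => ?_
  ring

/-- Gauss's identity `∑ q^{t (t + 1) / 2} = 2 J₂² / J₁`, with `t` running over all integers. -/
theorem tsum_zpow_tri {q : ℂ} (hq0 : q ≠ 0) (hq : ‖q‖ < 1) :
    (∑' n : ℤ, q ^ tri n) * J 1 q = 2 * J 2 q ^ 2 := by
  have hq2 : ‖q ^ 2‖ < 1 := by rw [norm_pow]; exact pow_lt_one₀ (norm_nonneg _) hq two_ne_zero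
  have hJ := J_one_ne_zero hq
  set E : ℕ → ℂ := fun N => ∏ i ∈ range N, (1 + q ^ (i + 1)) with hE
  have hEt : Tendsto E atTop (𝓝 (J 2 q / J 1 q)) := by
    rw [J_eq_J_one_pow 2]
    refine ((tendsto_qPoch hq2).div (tendsto_qPoch hq) hJ).congr fun N => ?_
    rw [Pi.div_apply, qPoch_sq, mul_div_cancel_left₀ _ (qPoch_ne_zero hq N)]
  have hfin : ∀ N : ℕ, ∑ k ∈ range (2 * (N + 1) + 1),
      q ^ tri ((k : ℤ) - (N + 1 : ℕ)) * gaussBinom q (2 * (N + 1)) k = E (N + 1) * (2 * E N) := by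
    intro N
    -- At `z = -1` the alternating signs combine to a constant, and the factor `i = 0` of the second
    -- product is the source of the `2`.
    have h := finite_triple_product hq0 (N + 1) (-1)
    rw [prod_mul_distrib] at h
    have e1 : ∏ i ∈ range (N + 1), (1 - (-1) * q ^ (i + 1)) = E (N + 1) :=
      prod_congr rfl fun i _ => by ring
    have e2 : ∏ i ∈ range (N + 1), (-1 - q ^ i) = (-1) ^ (N + 1) * (2 * E N) := by
      rw [prod_congr rfl (fun i _ => show -1 - q ^ i = -1 * (1 + q ^ i) by ring),
        prod_mul_distrib, prod_const, card_range, prod_range_succ' (fun i => 1 + q ^ i)]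
      rw [hE]; ring
    rw [e1, e2] at h
    have e3 : ∀ k ∈ range (2 * (N + 1) + 1),
        (-1) ^ ((k : ℤ) - (N + 1 : ℕ)) * q ^ tri ((k : ℤ) - (N + 1 : ℕ)) *
          gaussBinom q (2 * (N + 1)) k * (-1) ^ k =
        (-1) ^ (N + 1) * (q ^ tri ((k : ℤ) - (N + 1 : ℕ)) * gaussBinom q (2 * (N + 1)) k) := by
      intro k _
      have : ((-1 : ℂ)) ^ ((k : ℤ) - (N + 1 : ℕ)) * (-1) ^ k = (-1) ^ (N + 1) := by
        rw [← zpow_natCast (-1 : ℂ) k, ← zpow_natCast (-1 : ℂ) (N + 1),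
          ← zpow_add₀ (by norm_num)]
        rw [show (k : ℤ) - (N + 1 : ℕ) + k = (N + 1 : ℕ) + 2 * (k - (N + 1 : ℕ)) by ring,
          zpow_add₀ (by norm_num), zpow_mul]
        norm_num
      linear_combination (q ^ tri ((k : ℤ) - (N + 1 : ℕ)) * gaussBinom q (2 * (N + 1)) k) * this
    rw [sum_congr rfl e3, ← mul_sum] at h
    have hne : ((-1 : ℂ)) ^ (N + 1) ≠ 0 := pow_ne_zero _ (by norm_num)
    refine mul_left_cancel₀ hne ?_
    rw [← h]; ring
  have h := (tendsto_sum_mul_gaussBinom hq (summable_zpow_tri hq0 hq)).comp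
    (tendsto_add_atTop_nat 1)
  have h2 := (hEt.comp (tendsto_add_atTop_nat 1)).mul (hEt.const_mul 2)
  have := tendsto_nhds_unique (h.congr fun N => by simpa using hfin N) h2
  field_simp at this
  linear_combination this

/-! ### The double sum over `|j| ≤ n` and its product with the theta series -/

/-- Pairs `(n, j)` with `n ≥ 0` and `|j| ≤ n`; the second component stores `j + n`. -/
abbrev TriIndex : Type := (n : ℕ) × Fin (2 * n + 1)

/-- The integer `j` of the pair `(n, j)`. -/
def TriIndex.j (p : TriIndex) : ℤ := (p.2 : ℤ) - p.1

/-- The term `(-1)^n q^{n (n + 1) - j (j + 1) / 2}`. -/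
noncomputable def triTerm (q : ℂ) (p : TriIndex) : ℂ :=
  (-1) ^ p.1 * q ^ ((p.1 : ℤ) * (p.1 + 1) - tri p.j)

/-- For `|j| ≤ n` one has `tri j ≤ n (n + 1) / 2`. The bound dominates the `2n + 1` terms of row `n`
by `‖q‖ ^ n`, whence absolute convergence. -/
theorem TriIndex.le_exponent (p : TriIndex) : (p.1 : ℤ) ≤ (p.1 : ℤ) * (p.1 + 1) - tri p.j := by
  obtain ⟨n, i, hi⟩ := p
  have h := two_mul_tri (TriIndex.j ⟨n, i, hi⟩)
  simp only [TriIndex.j] at h ⊢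
  have h1 : (0 : ℤ) ≤ i := by omega
  have h2 : (i : ℤ) ≤ 2 * n := by omega
  have h3 : (n : ℤ) ≤ n * n := by exact_mod_cast Nat.le_mul_self n
  nlinarith [mul_nonneg h1 (sub_nonneg.2 h2)]

theorem summable_norm_triTerm {q : ℂ} (hq0 : q ≠ 0) (hq : ‖q‖ < 1) :
    Summable fun p : TriIndex => ‖triTerm q p‖ := by
  have hpos : 0 < ‖q‖ := norm_pos_iff.2 hq0
  have hb : ∀ p : TriIndex, ‖triTerm q p‖ ≤ ‖q‖ ^ p.1 := fun p => by
    rw [triTerm, norm_mul, norm_pow, norm_neg, norm_one, one_pow, one_mul, norm_zpow,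
      ← zpow_natCast]
    exact zpow_le_zpow_right_of_le_one₀ hpos hq.le p.le_exponent
  rw [summable_sigma_of_nonneg fun p => norm_nonneg _]
  refine ⟨fun n => Summable.of_finite, ?_⟩
  have h1 := summable_pow_mul_geometric_of_norm_lt_one 1 (r := ‖q‖) (by simpa using hq)
  have h2 := summable_geometric_of_lt_one (norm_nonneg q) hq
  refine ((h1.mul_left 2).add h2).of_nonneg_of_le
    (fun n => tsum_nonneg fun _ => norm_nonneg _) fun n => ?_
  rw [tsum_fintype]
  refine (sum_le_card_nsmul _ _ (‖q‖ ^ n) fun i _ => hb ⟨n, i⟩).trans (le_of_eq ?_)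
  simp
  ring

theorem summable_zpow_tri_two_mul_add {q : ℂ} (hq0 : q ≠ 0) (hq : ‖q‖ < 1) (j : ℤ) :
    Summable fun a : ℤ => q ^ tri (2 * a + j) :=
  (summable_zpow_tri hq0 hq).of_norm.comp_injective (i := fun a : ℤ => 2 * a + j)
    fun a b h => by simpa using h

theorem hasSum_int_even_add_odd {f : ℤ → ℂ} {x y : ℂ} (he : HasSum (fun a : ℤ => f (2 * a)) x)
    (ho : HasSum (fun a : ℤ => f (2 * a + 1)) y) : HasSum f (x + y) := by
  have hi : Function.Injective fun a : ℤ => 2 * a := fun a b h => by simpa using h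
  have hi' : Function.Injective fun a : ℤ => 2 * a + 1 := fun a b h => by simpa using h
  refine HasSum.add_isCompl ?_ (hi.hasSum_range_iff.2 he) (hi'.hasSum_range_iff.2 ho)
  have h1 : (Set.range fun a : ℤ => 2 * a) = {n | Even n} := by
    ext n; simp [even_iff_exists_two_mul]
  have h2 : (Set.range fun a : ℤ => 2 * a + 1) = {n | Odd n} := by
    ext n; simp [Odd]
  rw [h1, h2]
  exact Int.isCompl_even_odd

/-- The sum of `q^{t (t + 1) / 2}` over one residue class modulo `2` is half of the full sum. -/
theorem two_mul_tsum_zpow_tri {q : ℂ} (hq0 : q ≠ 0) (hq : ‖q‖ < 1) (j : ℤ) :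
    2 * ∑' a : ℤ, q ^ tri (2 * a + j) = ∑' t : ℤ, q ^ tri t := by
  have shift : ∀ j m : ℤ, ∑' a : ℤ, q ^ tri (2 * a + (j + 2 * m)) = ∑' a : ℤ, q ^ tri (2 * a + j) :=
    fun j m => by
      rw [← (Equiv.addRight m).tsum_eq (fun a : ℤ => q ^ tri (2 * a + j))]
      refine tsum_congr fun a => ?_
      rw [Equiv.coe_addRight]; congr 2; ring
  -- The reflection `t ↦ -1 - t` preserves `tri` and exchanges the parities.
  have flip : ∑' a : ℤ, q ^ tri (2 * a + 1) = ∑' a : ℤ, q ^ tri (2 * a) := by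
    rw [← (Equiv.subLeft (-1 : ℤ)).tsum_eq (fun a : ℤ => q ^ tri (2 * a))]
    refine tsum_congr fun a => ?_
    rw [Equiv.subLeft_apply, ← tri_neg_one_sub]; congr 2; ring
  have he : Summable fun a : ℤ => q ^ tri (2 * a) := by
    simpa using summable_zpow_tri_two_mul_add hq0 hq 0
  have hs : ∑' t : ℤ, q ^ tri t = 2 * ∑' a : ℤ, q ^ tri (2 * a) := by
    rw [(hasSum_int_even_add_odd (f := fun t : ℤ => q ^ tri t) he.hasSum
      (summable_zpow_tri_two_mul_add hq0 hq 1).hasSum).tsum_eq, flip, two_mul]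
  rw [hs]
  congr 1
  rcases Int.even_or_odd' j with ⟨m, rfl | rfl⟩
  · simpa using shift 0 m
  · rw [add_comm (2 * m), shift 1 m, flip]

/-- The alternating sum of `q^{k (k + 1)}` over all integers is zero. -/
theorem tsum_neg_one_zpow_mul_sq (q : ℂ) :
    ∑' k : ℤ, (-1 : ℂ) ^ k * q ^ (k * (k + 1)) = 0 := by
  have h : ∑' k : ℤ, (-1 : ℂ) ^ k * q ^ (k * (k + 1)) =
      -∑' k : ℤ, (-1 : ℂ) ^ k * q ^ (k * (k + 1)) := by
    -- The reflection `k ↦ -1 - k` fixes `k (k + 1)` and reverses the sign, so the sum equals its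
    -- negative.
    conv_lhs => rw [← (Equiv.subLeft (-1 : ℤ)).tsum_eq]
    rw [← tsum_neg]
    refine tsum_congr fun k => ?_
    rw [Equiv.subLeft_apply, zpow_sub₀ (by norm_num : (-1 : ℂ) ≠ 0),
      show (-1 - k) * (-1 - k + 1) = k * (k + 1) by ring, div_eq_mul_inv, ← inv_zpow]
    norm_num
  exact self_eq_neg.1 h

theorem zpow_mul_succ_eq (q : ℂ) (k : ℤ) : q ^ (k * (k + 1)) = (q ^ 2) ^ tri k := by
  rw [← two_mul_tri, zpow_mul]; rfl

theorem norm_sq_lt_one {q : ℂ} (hq : ‖q‖ < 1) : ‖q ^ 2‖ < 1 := by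
  rw [norm_pow]; exact pow_lt_one₀ (norm_nonneg _) hq two_ne_zero

/-- Substituting `k = m - a` in the vanishing series of `(-1)^k q^{k (k + 1)}` gives this one up to
a nonzero factor. -/
theorem hasSum_neg_one_zpow_mul {q : ℂ} (hq0 : q ≠ 0) (hq : ‖q‖ < 1) (a : ℤ) :
    HasSum (fun m : ℤ => (-1 : ℂ) ^ m * q ^ (m * (m + 1) - 2 * a * m)) 0 := by
  have hs : Summable fun k : ℤ => (-1 : ℂ) ^ k * q ^ (k * (k + 1)) := by
    refine Summable.of_norm ((summable_zpow_tri (pow_ne_zero 2 hq0) (norm_sq_lt_one hq)).congr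
      fun k => ?_)
    rw [norm_mul, norm_neg_one_zpow, one_mul, zpow_mul_succ_eq]
  have h := hs.hasSum
  rw [tsum_neg_one_zpow_mul_sq, ← (Equiv.addRight (-a)).hasSum_iff] at h
  have h' := h.mul_left ((-1) ^ a * q ^ (a - a * a))
  rw [mul_zero] at h'
  refine Eq.subst (motive := fun f => HasSum f 0) (funext fun m => ?_) h'
  have e : (-1 : ℂ) ^ a * (-1) ^ (m + -a) = (-1) ^ m := by
    rw [← zpow_add₀ (by norm_num)]; congr 1; ring
  rw [Function.comp_apply, Equiv.coe_addRight, mul_mul_mul_comm, e, ← zpow_add₀ hq0]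
  congr 2
  ring

theorem geom_sum_zpow_two_mul {q : ℂ} (hq0 : q ≠ 0) (n : ℕ) (a : ℤ) :
    (1 - q ^ (2 * a)) * ∑ i : Fin (2 * n + 1), q ^ (2 * a * ((i : ℤ) - n)) =
      q ^ (-(2 * a * n)) - q ^ (2 * a * (n + 1)) := by
  have e : ∀ i : ℕ, q ^ (2 * a * ((i : ℤ) - n)) = q ^ (-(2 * a * n)) * (q ^ (2 * a)) ^ i := by
    intro i
    rw [← zpow_natCast, ← zpow_mul, ← zpow_add₀ hq0]; congr 1; ring
  rw [Fin.sum_univ_eq_sum_range (fun i : ℕ => q ^ (2 * a * ((i : ℤ) - n)))]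
  simp_rw [e]
  rw [← mul_sum, mul_left_comm, mul_neg_geom_sum, mul_sub, mul_one, ← zpow_natCast, ← zpow_mul,
    ← zpow_add₀ hq0]
  congr 2
  push_cast; ring

theorem neg_one_zpow_neg_one_sub (n : ℤ) : (-1 : ℂ) ^ (-1 - n) = -(-1) ^ n := by
  rw [zpow_sub₀ (by norm_num), div_eq_mul_inv, ← inv_zpow]
  norm_num

/-- The term of the triple sum obtained on multiplying the double sum by the theta series. -/
noncomputable def tripleTerm (q : ℂ) (p : TriIndex) (a : ℤ) : ℂ :=
  (-1) ^ p.1 * q ^ ((p.1 : ℤ) * (p.1 + 1) + 2 * a * a + a * (2 * p.j + 1))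

theorem tripleTerm_eq {q : ℂ} (hq0 : q ≠ 0) (p : TriIndex) (a : ℤ) :
    tripleTerm q p a = triTerm q p * q ^ tri (2 * a + p.j) := by
  rw [tripleTerm, triTerm, mul_assoc ((-1 : ℂ) ^ p.1), ← zpow_add₀ hq0]
  congr 2
  have h1 := two_mul_tri p.j
  have h2 := two_mul_tri (2 * a + p.j)
  refine mul_left_cancel₀ (two_ne_zero (α := ℤ)) ?_
  linear_combination h1 - h2

/-- A subfamily, along `(p, a) ↦ (p, 2a + j)`, of the product of two absolutely convergent series.
It justifies summing over `p` before `a`. -/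
theorem summable_tripleTerm {q : ℂ} (hq0 : q ≠ 0) (hq : ‖q‖ < 1) :
    Summable (Function.uncurry (tripleTerm q)) := by
  have h := summable_mul_of_summable_norm (summable_norm_triTerm hq0 hq) (summable_zpow_tri hq0 hq)
  have hi : Function.Injective fun x : TriIndex × ℤ => (x.1, 2 * x.2 + x.1.j) := by
    rintro ⟨p, a⟩ ⟨p', a'⟩ h
    simp only [Prod.mk.injEq] at h
    obtain ⟨rfl, h⟩ := h
    simpa using h
  exact (h.comp_injective hi).congr fun x => (tripleTerm_eq hq0 x.1 x.2).symm

theorem tsum_tripleTerm_eq {q : ℂ} (hq0 : q ≠ 0) (hq : ‖q‖ < 1) (a : ℤ) :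
    ∑' p, tripleTerm q p a = q ^ (2 * a * a + a) * ∑' n : ℕ, (-1) ^ n * q ^ ((n : ℤ) * (n + 1)) *
      ∑ i : Fin (2 * n + 1), q ^ (2 * a * ((i : ℤ) - n)) := by
  have hs : Summable fun p => tripleTerm q p a :=
    (summable_tripleTerm hq0 hq).comp_injective (i := fun p => (p, a)) fun _ _ h => by
      simpa using h
  rw [hs.tsum_sigma, ← tsum_mul_left]
  refine tsum_congr fun n => ?_
  rw [tsum_fintype, mul_sum, mul_sum]
  refine sum_congr rfl fun i _ => ?_
  rw [tripleTerm, TriIndex.j, mul_assoc ((-1 : ℂ) ^ n), mul_left_comm (q ^ (2 * a * a + a)),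
    ← zpow_add₀ hq0, ← zpow_add₀ hq0]
  congr 2
  ring

theorem tsum_tripleTerm_of_ne_zero {q : ℂ} (hq0 : q ≠ 0) (hq : ‖q‖ < 1) {a : ℤ} (ha : a ≠ 0) :
    ∑' p, tripleTerm q p a = 0 := by
  have hx : 1 - q ^ (2 * a) ≠ 0 := by
    intro h
    have h1 : ‖q‖ ^ (2 * a) = 1 := by rw [← norm_zpow, ← sub_eq_zero.1 h, norm_one]
    have := (zpow_eq_one_iff_right₀ (norm_nonneg q) hq.ne).1 h1
    omega
  rw [tsum_tripleTerm_eq hq0 hq]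
  refine mul_eq_zero_of_right _ (mul_left_cancel₀ hx ?_)
  -- After multiplication by `1 - q^{2a}`, the two surviving ends of row `n` are the terms `m = n`
  -- and `m = -(n + 1)` of the vanishing bilateral series.
  rw [mul_zero, ← tsum_mul_left, ← (hasSum_neg_one_zpow_mul hq0 hq a).nat_add_neg_add_one.tsum_eq]
  refine tsum_congr fun n => ?_
  rw [mul_left_comm, geom_sum_zpow_two_mul hq0, mul_sub, mul_assoc ((-1 : ℂ) ^ n),
    mul_assoc ((-1 : ℂ) ^ n), ← zpow_add₀ hq0, ← zpow_add₀ hq0, sub_eq_add_neg, ← neg_mul]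
  have e : (-1 : ℂ) ^ (-((n : ℤ) + 1)) = -(-1) ^ n := by
    rw [show -((n : ℤ) + 1) = -1 - n by ring, neg_one_zpow_neg_one_sub, zpow_natCast]
  rw [e, zpow_natCast, neg_mul]
  congr 4
  ring_nf

theorem tsum_tripleTerm_zero {q : ℂ} (hq0 : q ≠ 0) (hq : ‖q‖ < 1) :
    ∑' p, tripleTerm q p 0 = J 2 q ^ 3 := by
  have hq2 := pow_ne_zero 2 hq0
  have h := (summable_neg_one_mul_zpow_tri hq2 (norm_sq_lt_one hq)).of_norm.hasSum
  rw [tsum_neg_one_mul_zpow_tri hq2 (norm_sq_lt_one hq), ← J_eq_J_one_pow] at h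
  -- In Jacobi's series for `q²`, the terms at `n` and `-(n + 1)` combine with weight `n + (n + 1)`,
  -- the length `2n + 1` of the row.
  rw [tsum_tripleTerm_eq hq0 hq, ← h.nat_add_neg_add_one.tsum_eq]
  simp only [mul_zero, zero_mul, add_zero, zpow_zero, one_mul]
  refine tsum_congr fun n => ?_
  have e : (-1 : ℂ) ^ (-((n : ℤ) + 1)) = -(-1) ^ n := by
    rw [show -((n : ℤ) + 1) = -1 - n by ring, neg_one_zpow_neg_one_sub, zpow_natCast]
  rw [e, zpow_natCast, show -((n : ℤ) + 1) = -1 - n by ring, tri_neg_one_sub, ← zpow_mul_succ_eq]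
  simp
  ring

/-- The evaluation `∑_{n ≥ 0} ∑_{|j| ≤ n} (-1)^n q^{n (n + 1) - j (j + 1) / 2} = J₁ J₂`. -/
theorem tsum_triTerm {q : ℂ} (hq0 : q ≠ 0) (hq : ‖q‖ < 1) :
    ∑' p, triTerm q p = J 1 q * J 2 q := by
  have h1 : (∑' p, triTerm q p) * (∑' t : ℤ, q ^ tri t) = 2 * J 2 q ^ 3 := by
    rw [← tsum_mul_right]
    have : ∀ p, triTerm q p * (∑' t : ℤ, q ^ tri t) = 2 * ∑' a, tripleTerm q p a := fun p => by
      rw [← two_mul_tsum_zpow_tri hq0 hq p.j, mul_left_comm, ← tsum_mul_left]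
      simp_rw [tripleTerm_eq hq0]
    simp_rw [this]
    rw [tsum_mul_left, ← (summable_tripleTerm hq0 hq).tsum_comm,
      tsum_eq_single 0 fun a ha => tsum_tripleTerm_of_ne_zero hq0 hq ha,
      tsum_tripleTerm_zero hq0 hq]
  have h2 := tsum_zpow_tri hq0 hq
  have hJ2 : J 2 q ≠ 0 := by
    rw [J_eq_J_one_pow]; exact J_one_ne_zero (norm_sq_lt_one hq)
  refine mul_right_cancel₀ (mul_ne_zero two_ne_zero (pow_ne_zero 2 hJ2)) ?_
  linear_combination J 1 q * h1 - (∑' p, triTerm q p) * h2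

/-! ### From the Hecke-type sum to the sum over `|j| ≤ n` -/

theorem two_mul_binom2 (r : ℤ) : 2 * binom2 r = r * (r - 1) := by
  have h : (2 : ℤ) ∣ r * (r - 1) := by
    have := (Int.even_mul_succ_self (r - 1)).two_dvd
    rwa [sub_add_cancel, mul_comm] at this
  exact Int.mul_ediv_cancel' h

theorem heckeTerm_eq {q : ℂ} (hq0 : q ≠ 0) (p : ℤ × ℤ) :
    heckeTerm 2 2 1 (q ^ 2) q q p =
      (-1) ^ (p.1 + p.2) * q ^ ((p.1 + p.2) * (p.1 + p.2 + 1) - tri p.2) := by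
  rw [heckeTerm, ← zpow_natCast q 2, ← zpow_mul, mul_assoc, mul_assoc, ← zpow_add₀ hq0,
    ← zpow_add₀ hq0]
  congr 2
  have h1 := two_mul_binom2 p.1
  have h2 := two_mul_binom2 p.2
  have h3 := two_mul_tri p.2
  refine mul_left_cancel₀ (two_ne_zero (α := ℤ)) ?_
  push_cast
  linear_combination 2 * h1 + h2 + h3

theorem TriIndex.neg_le_j (p : TriIndex) : -(p.1 : ℤ) ≤ p.j := by
  unfold TriIndex.j; omega

theorem TriIndex.j_le (p : TriIndex) : p.j ≤ p.1 := by
  have := p.2.2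
  unfold TriIndex.j; omega

theorem TriIndex.ext_j : ∀ {p p' : TriIndex}, p.1 = p'.1 → p.j = p'.j → p = p'
  | ⟨n, i, hi⟩, ⟨n', i', hi'⟩, h, hj => by
    obtain rfl : n = n' := h
    obtain rfl : i = i' := by simpa [TriIndex.j] using hj
    rfl

/-- The index with given integers `n` and `j`. -/
def TriIndex.ofInt (n j : ℤ) (_h1 : -n ≤ j) (h2 : j ≤ n) : TriIndex :=
  ⟨n.toNat, ⟨(j + n).toNat, by omega⟩⟩

theorem TriIndex.ofInt_fst {n j : ℤ} (h1 : -n ≤ j) (h2 : j ≤ n) :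
    ((ofInt n j h1 h2).1 : ℤ) = n := by
  simp only [ofInt]; omega

theorem TriIndex.ofInt_j {n j : ℤ} (h1 : -n ≤ j) (h2 : j ≤ n) : (ofInt n j h1 h2).j = j := by
  simp only [ofInt, TriIndex.j]; omega

/-- The bijection from the two quadrants to the index set `|j| ≤ n`, given by
`(r, s) ↦ (r + s, s)` and `(r, s) ↦ (-1 - r - s, s)`. -/
def quadrantsToTri : nonnegQuadrant ⊕ negQuadrant → TriIndex :=
  Sum.elim
    (fun p => TriIndex.ofInt (p.1.1 + p.1.2) p.1.2 (by have := p.2.1; have := p.2.2; omega)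
      (by have := p.2.1; omega))
    (fun p => TriIndex.ofInt (-1 - p.1.1 - p.1.2) p.1.2 (by have := p.2.1; omega)
      (by have := p.2.1; have := p.2.2; omega))

/-- The sign of `j = s` identifies the quadrant, and then `n` determines `r`; the condition on `r`
becomes `j ≤ n` in the first case and `-n ≤ j` in the second. -/
theorem quadrantsToTri_bijective : Function.Bijective quadrantsToTri := by
  constructor
  · intro x y h
    have h1 := congrArg (fun p : TriIndex => (p.1 : ℤ)) h
    have h2 := congrArg TriIndex.j h
    rcases x with ⟨⟨r, s⟩, hr, hs⟩ | ⟨⟨r, s⟩, hr, hs⟩ <;>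
      rcases y with ⟨⟨r', s'⟩, hr', hs'⟩ | ⟨⟨r', s'⟩, hr', hs'⟩ <;>
      simp only [quadrantsToTri, Sum.elim_inl, Sum.elim_inr, TriIndex.ofInt_fst,
        TriIndex.ofInt_j] at h1 h2 hr hs hr' hs'
    · obtain rfl : s = s' := h2
      obtain rfl : r = r' := by omega
      rfl
    · omega
    · omega
    · obtain rfl : s = s' := h2
      obtain rfl : r = r' := by omega
      rfl
  · intro p
    have h1 := p.neg_le_j
    have h2 := p.j_le
    rcases le_or_gt 0 p.j with h | h
    · refine ⟨Sum.inl ⟨(p.1 - p.j, p.j), ⟨by simp only; omega, h⟩⟩, ?_⟩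
      refine TriIndex.ext_j (Nat.cast_injective (R := ℤ) ?_) ?_ <;>
        simp only [quadrantsToTri, Sum.elim_inl, TriIndex.ofInt_fst, TriIndex.ofInt_j]
      omega
    · refine ⟨Sum.inr ⟨(-1 - p.1 - p.j, p.j), ⟨by simp only; omega, h⟩⟩, ?_⟩
      refine TriIndex.ext_j (Nat.cast_injective (R := ℤ) ?_) ?_ <;>
        simp only [quadrantsToTri, Sum.elim_inr, TriIndex.ofInt_fst, TriIndex.ofInt_j]
      omega

theorem triTerm_quadrantsToTri_inl {q : ℂ} (hq0 : q ≠ 0) (p : nonnegQuadrant) :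
    triTerm q (quadrantsToTri (Sum.inl p)) = heckeTerm 2 2 1 (q ^ 2) q q p := by
  rw [heckeTerm_eq hq0, triTerm, ← zpow_natCast]
  simp only [quadrantsToTri, Sum.elim_inl, TriIndex.ofInt_fst, TriIndex.ofInt_j]

theorem triTerm_quadrantsToTri_inr {q : ℂ} (hq0 : q ≠ 0) (p : negQuadrant) :
    triTerm q (quadrantsToTri (Sum.inr p)) = -heckeTerm 2 2 1 (q ^ 2) q q p := by
  rw [heckeTerm_eq hq0, triTerm, ← zpow_natCast]
  simp only [quadrantsToTri, Sum.elim_inr, TriIndex.ofInt_fst, TriIndex.ofInt_j]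
  rw [sub_sub, neg_one_zpow_neg_one_sub, neg_mul]
  congr 3
  ring

theorem summable_triTerm_quadrants {q : ℂ} (hq0 : q ≠ 0) (hq : ‖q‖ < 1) :
    Summable fun x => triTerm q (quadrantsToTri x) :=
  (summable_norm_triTerm hq0 hq).of_norm.comp_injective quadrantsToTri_bijective.1

theorem summable_heckeTerm_nonneg {q : ℂ} (hq0 : q ≠ 0) (hq : ‖q‖ < 1) :
    Summable fun p : nonnegQuadrant => heckeTerm 2 2 1 (q ^ 2) q q p :=
  ((summable_triTerm_quadrants hq0 hq).comp_injective Sum.inl_injective).congr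
    fun p => triTerm_quadrantsToTri_inl hq0 p

theorem summable_heckeTerm_neg {q : ℂ} (hq0 : q ≠ 0) (hq : ‖q‖ < 1) :
    Summable fun p : negQuadrant => heckeTerm 2 2 1 (q ^ 2) q q p :=
  ((summable_triTerm_quadrants hq0 hq).comp_injective Sum.inr_injective).neg.congr
    fun p => by simp [triTerm_quadrantsToTri_inr hq0]

theorem heckeF_eq_tsum_triTerm {q : ℂ} (hq0 : q ≠ 0) (hq : ‖q‖ < 1) :
    heckeF 2 2 1 (q ^ 2) q q = ∑' p, triTerm q p := by
  rw [← (Equiv.ofBijective _ quadrantsToTri_bijective).tsum_eq]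
  have h := summable_triTerm_quadrants hq0 hq
  have hs := (h.comp_injective Sum.inl_injective).hasSum.sum (f := fun x =>
    triTerm q (quadrantsToTri x)) (h.comp_injective Sum.inr_injective).hasSum
  simp only [Equiv.ofBijective_apply]
  rw [hs.tsum_eq, heckeF, sub_eq_add_neg, ← tsum_neg]
  simp [triTerm_quadrantsToTri_inl hq0, triTerm_quadrantsToTri_inr hq0]

/-! ### The Kac–Peterson index set -/

/-- The point of the Kac–Peterson index set that belongs to `(n, j)`. -/
noncomputable def kpPoint (p : TriIndex) : ℝ × ℝ :=
  ((-1) ^ p.1 * ((2 * p.1 + 1) / 4), (2 * p.j + 1) / 4)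

theorem abs_kpPoint_fst (p : TriIndex) : |(kpPoint p).1| = (2 * p.1 + 1) / 4 := by
  rw [kpPoint, abs_mul, abs_pow, abs_neg, abs_one, one_pow, one_mul, abs_of_pos (by positivity)]

theorem kpPoint_mem (p : TriIndex) : kpPoint p ∈ kpIndex 2 1 1 := by
  have h1 : -(p.1 : ℝ) ≤ p.j := by exact_mod_cast p.neg_le_j
  have h2 : (p.j : ℝ) ≤ p.1 := by exact_mod_cast p.j_le
  have hx : ∃ a : ℤ, (kpPoint p).1 = 1 / 4 + a := by
    rcases Nat.even_or_odd' p.1 with ⟨m, h | h⟩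
    · refine ⟨m, ?_⟩
      simp only [kpPoint, h, pow_mul]; push_cast; norm_num; ring
    · refine ⟨-m - 1, ?_⟩
      simp only [kpPoint, h, pow_succ, pow_mul]; push_cast; norm_num; ring
  obtain ⟨a, ha⟩ := hx
  refine ⟨?_, ?_, ?_⟩
  · rw [abs_kpPoint_fst]; simp only [kpPoint]; linarith
  · rw [abs_kpPoint_fst]; simp only [kpPoint]; linarith
  · rw [ha]
    -- The parity of `j` decides which of the two lattice conditions holds.
    rcases Int.even_or_odd' p.j with ⟨b, h | h⟩
    · refine Or.inl ⟨a, b, by norm_num, ?_⟩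
      simp only [kpPoint, h]; push_cast; ring
    · refine Or.inr ⟨-a, b + 1, by push_cast; ring, ?_⟩
      simp only [kpPoint, h]; push_cast; ring

/-- The parametrization of the Kac–Peterson index set by pairs `(n, j)` with `|j| ≤ n`. -/
noncomputable def triToKp (p : TriIndex) : kpIndex 2 1 1 := ⟨kpPoint p, kpPoint_mem p⟩

/-- Each `x` in `1/4 + ℤ` is `(-1)^n (2n + 1) / 4` for exactly one `n ≥ 0`, and `-|x| < y ≤ |x|`
with `y = (2j + 1) / 4` means `-n ≤ j ≤ n`, the strict lower bound excluding `j = -n - 1`. -/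
theorem triToKp_bijective : Function.Bijective triToKp := by
  constructor
  · intro p p' h
    have h' : kpPoint p = kpPoint p' := congrArg Subtype.val h
    have h1 : ((2 * p.1 + 1) / 4 : ℝ) = (2 * p'.1 + 1) / 4 := by
      rw [← abs_kpPoint_fst, ← abs_kpPoint_fst, h']
    have h2 : ((2 * p.j + 1) / 4 : ℝ) = (2 * p'.j + 1) / 4 := congrArg Prod.snd h'
    refine TriIndex.ext_j ?_ ?_
    · have : (p.1 : ℝ) = p'.1 := by linarith
      exact_mod_cast this
    · have : (p.j : ℝ) = p'.j := by linarith
      exact_mod_cast this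
  · rintro ⟨⟨x, y⟩, hy1, hy2, hl⟩
    simp only at hy1 hy2 hl
    have hxy : ∃ a j : ℤ, x = 1 / 4 + a ∧ y = (2 * j + 1) / 4 := by
      rcases hl with ⟨a, b, ha, hb⟩ | ⟨a, b, ha, hb⟩
      · refine ⟨a, 2 * b, by rw [ha]; norm_num, ?_⟩
        rw [hb]; push_cast; ring
      · refine ⟨-a, 2 * b - 1, ?_, ?_⟩
        · push_cast at ha ⊢; linarith
        · push_cast at hb ⊢; linarith
    obtain ⟨a, j, rfl, rfl⟩ := hxy
    have key : ∀ n : ℕ, (1 / 4 + a : ℝ) = (-1) ^ n * ((2 * n + 1) / 4) →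
        ∃ p, triToKp p = ⟨(1 / 4 + a, (2 * j + 1) / 4), hy1, hy2, hl⟩ := by
      intro n hn
      have habs : |(1 / 4 + a : ℝ)| = (2 * n + 1) / 4 := by
        rw [hn, abs_mul, abs_pow, abs_neg, abs_one, one_pow, one_mul, abs_of_pos (by positivity)]
      rw [habs] at hy1 hy2
      have b1 : -(n : ℤ) ≤ j := by
        have : (-(n : ℤ) - 1 : ℝ) < j := by push_cast; linarith
        have : -(n : ℤ) - 1 < j := by exact_mod_cast this
        omega
      have b2 : j ≤ n := by
        have : (j : ℝ) ≤ n := by linarith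
        exact_mod_cast this
      have e1 : (TriIndex.ofInt n j b1 b2).1 = n := by
        have := TriIndex.ofInt_fst b1 b2; exact_mod_cast this
      refine ⟨TriIndex.ofInt n j b1 b2, Subtype.ext ?_⟩
      simp only [triToKp, kpPoint, e1, TriIndex.ofInt_j, hn]
    rcases le_or_gt 0 a with h | h
    · lift a to ℕ using h
      refine key (2 * a) ?_
      rw [pow_mul]; push_cast; norm_num; ring
    · obtain ⟨m, rfl⟩ : ∃ m : ℕ, a = -m - 1 := ⟨(-a - 1).toNat, by omega⟩
      refine key (2 * m + 1) ?_
      rw [pow_succ, pow_mul]; push_cast; norm_num; ring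

theorem sg_kpPoint (p : TriIndex) : sg (kpPoint p).1 = (-1) ^ p.1 := by
  have hpos : (0 : ℝ) < (2 * p.1 + 1) / 4 := by positivity
  rcases Nat.even_or_odd p.1 with h | h
  · simp only [sg, kpPoint, h.neg_one_pow, one_mul, if_pos hpos.le]
  · simp only [sg, kpPoint, h.neg_one_pow, neg_one_mul]
    rw [if_neg (by linarith)]

theorem nome_zpow (τ : ℂ) (n : ℤ) :
    nome τ ^ n = Complex.exp (2 * Real.pi * Complex.I * τ * n) := by
  rw [nome, ← Complex.exp_int_mul]; ring_nf

/-- The form `4x² - 2y²` equals `(2n + 1)² / 4 - (2j + 1)² / 8 = n (n + 1) - tri j + 1/8`, and `sg`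
supplies the sign `(-1)^n`. -/
theorem kpTerm_triToKp (τ : ℂ) (p : TriIndex) :
    kpTerm 2 τ (triToKp p) =
      Complex.exp (2 * Real.pi * Complex.I * τ / 8) * triTerm (nome τ) p := by
  rw [kpTerm, triTerm, nome_zpow, mul_left_comm, ← Complex.exp_add]
  have hs : sg (triToKp p : ℝ × ℝ).1 = (-1) ^ p.1 := sg_kpPoint p
  rw [hs]
  congr 1
  · push_cast; rfl
  · congr 1
    have ht : (2 : ℂ) * (tri p.j : ℂ) = p.j * (p.j + 1) := by exact_mod_cast two_mul_tri p.j
    have hsq : ((-1 : ℂ) ^ p.1) ^ 2 = 1 := by rw [← pow_mul, mul_comm, pow_mul]; simp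
    simp only [triToKp, kpPoint]
    push_cast
    rw [mul_pow, hsq]
    linear_combination (2 * Real.pi * Complex.I * τ) * (1 / 2) * ht

theorem nome_ne_zero (τ : ℂ) : nome τ ≠ 0 := Complex.exp_ne_zero _

theorem norm_nome_lt_one (τ : ℍ) : ‖nome τ‖ < 1 := norm_exp_two_pi_I_lt_one τ

theorem summable_kpTerm (τ : ℍ) : Summable fun p : kpIndex 2 1 1 => kpTerm 2 τ p := by
  rw [← (Equiv.ofBijective _ triToKp_bijective).summable_iff]
  exact (((summable_norm_triTerm (nome_ne_zero τ) (norm_nome_lt_one τ)).of_norm).mul_left _).congr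
    fun p => (kpTerm_triToKp τ p).symm

theorem tsum_kpTerm (τ : ℍ) : ∑' p : kpIndex 2 1 1, kpTerm 2 τ p =
    Complex.exp (2 * Real.pi * Complex.I * τ / 8) *
      heckeF 2 2 1 (nome τ ^ 2) (nome τ) (nome τ) := by
  rw [← (Equiv.ofBijective _ triToKp_bijective).tsum_eq,
    heckeF_eq_tsum_triTerm (nome_ne_zero τ) (norm_nome_lt_one τ), ← tsum_mul_left]
  exact tsum_congr fun p => kpTerm_triToKp τ p

/-! ### Eta products -/

theorem eta_eq_exp_mul_J (z : ℂ) :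
    ModularForm.eta z = Complex.exp (2 * Real.pi * Complex.I * z / 24) * J 1 (nome z) := by
  simp only [ModularForm.eta, J, ModularForm.eta_q_eq_pow, nome, one_mul,
    Function.Periodic.qParam]
  norm_num

theorem nome_two_mul (z : ℂ) : nome (2 * z) = nome z ^ 2 := by
  rw [nome, nome, ← Complex.exp_nat_mul]; congr 1; push_cast; ring

theorem eta_mul_eta_two_mul (z : ℂ) : ModularForm.eta z * ModularForm.eta (2 * z) =
    Complex.exp (2 * Real.pi * Complex.I * z / 8) * (J 1 (nome z) * J 2 (nome z)) := by
  rw [eta_eq_exp_mul_J, eta_eq_exp_mul_J, nome_two_mul, ← J_eq_J_one_pow, mul_mul_mul_comm,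
    ← Complex.exp_add]
  congr 2
  ring

end HeckeString

theorem mainTheorem7 (τ : ℍ) :
    -- the double sum converges absolutely, and `f_{2,2,1}(q², q, q) = J₁ J₂`
    (Summable (fun p : HeckeString.nonnegQuadrant =>
        HeckeString.heckeTerm 2 2 1 (HeckeString.nome τ ^ 2) (HeckeString.nome τ)
          (HeckeString.nome τ) p) ∧
      Summable (fun p : HeckeString.negQuadrant =>
        HeckeString.heckeTerm 2 2 1 (HeckeString.nome τ ^ 2) (HeckeString.nome τ)
          (HeckeString.nome τ) p) ∧
      HeckeString.heckeF 2 2 1 (HeckeString.nome τ ^ 2) (HeckeString.nome τ)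
          (HeckeString.nome τ) =
        HeckeString.J 1 (HeckeString.nome τ) * HeckeString.J 2 (HeckeString.nome τ)) ∧
    -- the relation `η(τ)³ c₁₁¹¹ = q^{1/8} f_{2,2,1}(q², q, q)` behind the equivalence
    (Summable (fun p : HeckeString.kpIndex 2 1 1 => HeckeString.kpTerm 2 τ p) ∧
      ModularForm.eta τ ^ 3 * HeckeString.stringFunction 2 1 1 τ =
        Complex.exp (2 * Real.pi * Complex.I * τ / 8) *
          HeckeString.heckeF 2 2 1 (HeckeString.nome τ ^ 2) (HeckeString.nome τ)
            (HeckeString.nome τ)) ∧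
    -- the string function evaluation `c₁₁¹¹ = η(τ)⁻² η(2τ)`
    HeckeString.stringFunction 2 1 1 τ =
      (ModularForm.eta τ ^ 2)⁻¹ * ModularForm.eta (2 * (τ : ℂ)) := by
  have hq0 := HeckeString.nome_ne_zero τ
  have hq := HeckeString.norm_nome_lt_one τ
  have hη : ModularForm.eta τ ≠ 0 := ModularForm.eta_ne_zero τ.2
  have hf := (HeckeString.heckeF_eq_tsum_triTerm hq0 hq).trans (HeckeString.tsum_triTerm hq0 hq)
  have hc : ModularForm.eta τ ^ 3 * HeckeString.stringFunction 2 1 1 τ =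
      Complex.exp (2 * Real.pi * Complex.I * τ / 8) *
        HeckeString.heckeF 2 2 1 (HeckeString.nome τ ^ 2) (HeckeString.nome τ)
          (HeckeString.nome τ) := by
    rw [HeckeString.stringFunction, mul_inv_cancel_left₀ (pow_ne_zero 3 hη),
      HeckeString.tsum_kpTerm]
  refine ⟨⟨HeckeString.summable_heckeTerm_nonneg hq0 hq, HeckeString.summable_heckeTerm_neg hq0 hq,
    hf⟩, ⟨HeckeString.summable_kpTerm τ, hc⟩, ?_⟩
  refine mul_left_cancel₀ (pow_ne_zero 3 hη) ?_
  rw [hc, hf, ← HeckeString.eta_mul_eta_two_mul]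
  field_simp
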